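/- **Conventions.** $\mathbb N$ is the set of positive integers, and $x\approx y$ means $\lfloor y\rfloor\le x\le\lceil y\rceil$. A hypergraph $\mathscr G=(V,E,H,\psi,\phi)$ consists of disjoint finite sets $V=V(\mathscr G)$ (vertices), $E=E(\mathscr G)$ (edges), $H=H(\mathscr G)$ (hinges), a function $\psi:H\to V$ and a surjection $\phi:H\to E$. For $v\in V$, $e\in E$ put $H_{\mathscr G}(v,e)=\psi^{-1}(v)\cap\phi^{-1}(e)$; the degree of $v$ is $d_{\mathscr G}(v)=|\psi^{-1}(v)|$. For a finite multiset $U$ of vertices, in which $v$ has multiplicity $\mu_U(v)$, let $m_{\mathscr G}(U)$ be the number of edges $e$ such that $|H_{\mathscr G}(v,e)|=\mu_U(v)$ for all $v\in V$; write $m_{\mathscr G}(U_1,\dots,U_r)$ for $m_{\mathscr G}(U)$, where $\mu_U=\sum_i\mu_{U_i}$, and $m_{\mathscr G}(u_1^{m_1},\dots,u_r^{m_r})$ for $m_{\mathscr G}(U)$, where $U$ contains each $u_i$ exactly $m_i$ times and nothing else. A function $g:V\to\mathbb N$ is simple if $|H_{\mathscr G}(v,e)|\le g(v)$ for all $v\in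 V$, $e\in E$; the hypergraph $\mathscr G$ is simple if the constant function $1$ is simple. A $k$-edge-coloring is a map $E\to\{1,\dots,k\}$, and $\mathscr G(j)$ is the sub-hypergraph with vertex set $V$ formed by the edges of color $j$ and their hinges. Given $\mathscr F=(V,E,H,\psi,\phi)$ and $g:V\to\mathbb N$, a $g$-detachment of $\mathscr F$ with amalgamation function $\Psi$ is a hypergraph $\mathscr G=(W,E,H,\psi',\phi)$ together with a surjection $\Psi:W\to V$ such that $\psi=\Psi\circ\psi'$ and $|\Psi^{-1}(u)|=g(u)$ for all $u\in V$; an edge-coloring of $\mathscr F$ is then also one of $\mathscr G$. **Theorem 4.1.** Let $\mathscr F$ be a $k$-edge-colored hypergraph and let $g:V(\mathscr F)\to\mathbb N$ be a simple function. Then there exists a simple $g$-detachment $\mathscr G$ of $\mathscr F$ (possibly with multiple edges), with amalgamation function $\Psi:V(\mathscr G)\to V(\mathscr F)$, such that: - (A1) $d_{\mathscr G}(v)\approx d_{\mathscr F}(u)/g(u)$ for each $u\in V(\mathscr F)$ and each $v\in\Psi^{-1}(u)$; - (A2) $d_{\mathscr G(j)}(v)\approx d_{\mathscr F(j)}(u)/g(u)$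 for each $u\in V(\mathscr F)$, each $v\in\Psi^{-1}(u)$ and $1\le j\le k$; - (A3) $m_{\mathscr G}(U_1,\dots,U_r)\approx m_{\mathscr F}(u_1^{m_1},\dots,u_r^{m_r})\big/\prod_{i=1}^r\binom{g(u_i)}{m_i}$ for all distinct $u_1,\dots,u_r\in V(\mathscr F)$ and all sets $U_i\subseteq\Psi^{-1}(u_i)$ with $|U_i|=m_i\le g(u_i)$, $1\le i\le r$; - (A4) $m_{\mathscr G(j)}(U_1,\dots,U_r)\approx m_{\mathscr F(j)}(u_1^{m_1},\dots,u_r^{m_r})\big/\prod_{i=1}^r\binom{g(u_i)}{m_i}$ for all distinct $u_1,\dots,u_r\in V(\mathscr F)$, all sets $U_i\subseteq\Psi^{-1}(u_i)$ with $|U_i|=m_i\le g(u_i)$, $1\le i\le r$, and $1\le j\le k$. -/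

import Mathlib

/-- `FairShare x y` is the relation `x ≈ y`: `⌊y⌋ ≤ x ≤ ⌈y⌉`. It is not symmetric. -/
def FairShare (x y : ℝ) : Prop := (⌊y⌋ : ℝ) ≤ x ∧ x ≤ (⌈y⌉ : ℝ)

/-- A hypergraph in the hinge formalism, with vertex set `V`, edge set `E` and hinge set `H`.
The hinge `h` attaches the edge `edgeOf h` to the vertex `vertexOf h`; every edge has a hinge.
The sets are required to be finite where hypergraphs are quantified over. -/
structure HingeHypergraph (V E H : Type*) where
  vertexOf : H → V
  edgeOf : H → E
  edgeOf_surjective : Function.Surjective edgeOf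

universe u v w

namespace HingeHypergraph

/-- The hinges incident with the vertex `v`. -/
def hinges {V E H : Type*} (G : HingeHypergraph V E H) (v : V) : Set H :=
  {h | G.vertexOf h = v}

/-- The hinges incident with the vertex `v` and the edge `e`. -/
def hingesAt {V E H : Type*} (G : HingeHypergraph V E H) (v : V) (e : E) : Set H :=
  {h | G.vertexOf h = v ∧ G.edgeOf h = e}

/-- The degree of `v`: the number of hinges incident with it. -/
noncomputable def degree {V E H : Type*} (G : HingeHypergraph V E H) (v : V) : ℕ :=
  (G.hinges v).ncard

open Classical in
/-- `E(U)`: the edges which, for every vertex `v`, have exactly `μ_U(v)` hinges at `v`. -/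
def edgesJoining {V E H : Type*} (G : HingeHypergraph V E H) (U : Multiset V) : Set E :=
  {e | ∀ v, (G.hingesAt v e).ncard = U.count v}

/-- `m(U)`: the multiplicity of the multiset `U`. -/
noncomputable def multiplicity {V E H : Type*} (G : HingeHypergraph V E H)
    (U : Multiset V) : ℕ :=
  (G.edgesJoining U).ncard

/-- `G(j)`: the sub-hypergraph (on all the vertices) formed by the edges of colour `j`
and their hinges, for an edge-colouring `c`. -/
def colorClass {V E H C : Type*} (G : HingeHypergraph V E H) (c : E → C) (j : C) :
    HingeHypergraph V {e : E // c e = j} {h : H // c (G.edgeOf h) = j} where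
  vertexOf h := G.vertexOf h.1
  edgeOf h := ⟨G.edgeOf h.1, h.2⟩
  edgeOf_surjective := by
    rintro ⟨e, he⟩
    obtain ⟨h, rfl⟩ := G.edgeOf_surjective e
    exact ⟨⟨h, he⟩, rfl⟩

/-- The amalgamation of `G` under a map `Ψ` of its vertices. -/
def amalgamation {W V E H : Type*} (G : HingeHypergraph W E H) (Ψ : W → V) :
    HingeHypergraph V E H where
  vertexOf := Ψ ∘ G.vertexOf
  edgeOf := G.edgeOf
  edgeOf_surjective := G.edgeOf_surjective

/-- `G` is a `g`-detachment of `F` with amalgamation function `Ψ`: the map `Ψ` is onto,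
`F` is the amalgamation of `G` under `Ψ`, and `g` is the number function of `Ψ`. -/
def IsDetachment {W V E H : Type*} (G : HingeHypergraph W E H) (F : HingeHypergraph V E H)
    (Ψ : W → V) (g : V → ℕ) : Prop :=
  Function.Surjective Ψ ∧ G.amalgamation Ψ = F ∧ ∀ u, (Ψ ⁻¹' {u}).ncard = g u

/-- `g` is a simple function on the vertices of `G`. -/
def IsSimpleFun {V E H : Type*} (G : HingeHypergraph V E H) (g : V → ℕ) : Prop :=
  ∀ v e, (G.hingesAt v e).ncard ≤ g v

/-- `G` is simple: no edge has two hinges at one vertex. -/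
def IsSimple {V E H : Type*} (G : HingeHypergraph V E H) : Prop :=
  G.IsSimpleFun fun _ => 1

end HingeHypergraph

/-! The copies of a vertex are separated one at a time. If `g α > 1`, a set `A` of hinges at `α` is
moved to a new vertex which is never split again, leaving `g α - 1` copies at `α`. Everything
depends on choosing `A` so that it takes a fair `1 / g α` share of several sets of hinges at once.

The sets to be shared form two laminar families. One consists of the hinges of each prescribed edge
set `D` (all edges, or one colour) and of each single edge: these control degrees and keep the
number function simple. The other consists of the hinges of the edges in `D` that join a given
multiset `U`; different `U` give disjoint edge sets. Two laminar families can be rounded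
simultaneously (`exists_rounding`, `exists_fair_subset`), so `A` exists.

Each edge has at most one hinge in `A`, so fair shares of hinges become fair shares of edges, and
the identities relating binomial coefficients of `n` and `n + 1` convert these into the required
quotients (`splitOff_multiplicityIn`). Fairness is transitive and survives division by a positive
integer, so the errors of successive splittings do not accumulate. -/

/-- A laminar family: any two members are nested or disjoint. -/
def IsLaminar {α : Type*} [PartialOrder α] [OrderBot α] (𝒜 : Set α) : Prop :=
  ∀ P ∈ 𝒜, ∀ Q ∈ 𝒜, P ≤ Q ∨ Q ≤ P ∨ Disjoint P Q

theorem IsLaminar.mono {α : Type*} [PartialOrder α] [OrderBot α] {𝒜 ℬ : Set α}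
    (h : IsLaminar ℬ) (hs : 𝒜 ⊆ ℬ) : IsLaminar 𝒜 :=
  fun P hP Q hQ => h P (hs hP) Q (hs hQ)

/-! ### Simultaneous rounding for two laminar families. -/

section Rounding

open Finset

variable {S : Type*}

/-- The real number `y` is an integer. -/
def IsInt (y : ℝ) : Prop := ∃ z : ℤ, (z : ℝ) = y

theorem IsInt.add {a b : ℝ} (ha : IsInt a) (hb : IsInt b) : IsInt (a + b) := by
  obtain ⟨x, rfl⟩ := ha
  obtain ⟨y, rfl⟩ := hb
  exact ⟨x + y, by push_cast; rfl⟩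

theorem IsInt.sub {a b : ℝ} (ha : IsInt a) (hb : IsInt b) : IsInt (a - b) := by
  obtain ⟨x, rfl⟩ := ha
  obtain ⟨y, rfl⟩ := hb
  exact ⟨x - y, by push_cast; rfl⟩

theorem IsInt.sum {s : Finset S} {f : S → ℝ} (h : ∀ i ∈ s, IsInt (f i)) :
    IsInt (∑ i ∈ s, f i) := by
  classical
  induction s using Finset.induction_on with
  | empty => exact ⟨0, by simp⟩
  | insert a s ha ih =>
    rw [Finset.sum_insert ha]
    exact (h a (by simp)).add (ih fun i hi => h i (by simp [hi]))

/-- If the sum of `x` over every member of a laminar family is an integer, so is the sum over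
its union. -/
theorem IsLaminar.isInt_sum_biUnion [DecidableEq S] {x : S → ℝ} (𝒬 : Finset (Finset S))
    (hlam : IsLaminar (𝒬 : Set (Finset S))) (hint : ∀ Q ∈ 𝒬, IsInt (∑ s ∈ Q, x s)) :
    IsInt (∑ s ∈ 𝒬.biUnion id, x s) := by
  classical
  induction h𝒬 : 𝒬.card using Nat.strong_induction_on generalizing 𝒬 with
  | _ n ih =>
    rcases 𝒬.eq_empty_or_nonempty with rfl | hne
    · exact ⟨0, by simp⟩
    -- By laminarity a maximal member is disjoint from every member not contained in it, so it can
    -- be split off from the union.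
    obtain ⟨Q, hQ, hmax⟩ := 𝒬.exists_maximal hne
    set ℛ := 𝒬.filter fun R => ¬ R ⊆ Q with hℛ
    have hsub : ℛ ⊆ 𝒬 := Finset.filter_subset _ _
    have hlt : ℛ.card < n := by
      rw [← h𝒬]
      refine Finset.card_lt_card ⟨hsub, fun h => ?_⟩
      have := h hQ
      simp [hℛ] at this
    have hdis : Disjoint Q (ℛ.biUnion id) := by
      rw [Finset.disjoint_biUnion_right]
      intro R hR
      rw [hℛ, Finset.mem_filter] at hR
      rcases hlam Q hQ R hR.1 with h | h | h
      · exact absurd (hmax hR.1 h) hR.2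
      · exact absurd h hR.2
      · exact h
    have hU : 𝒬.biUnion id = Q ∪ ℛ.biUnion id := by
      ext s
      simp only [Finset.mem_biUnion, Finset.mem_union, id, hℛ, Finset.mem_filter]
      constructor
      · rintro ⟨R, hR, hs⟩
        by_cases h : R ⊆ Q
        · exact Or.inl (h hs)
        · exact Or.inr ⟨R, ⟨hR, h⟩, hs⟩
      · rintro (h | ⟨R, ⟨hR, -⟩, hs⟩)
        · exact ⟨Q, hQ, h⟩
        · exact ⟨R, hR, hs⟩
    rw [hU, Finset.sum_union hdis]
    exact (hint Q hQ).add (ih _ hlt ℛ (hlam.mono (by exact_mod_cast hsub))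
      (fun R hR => hint R (hsub hR)) rfl)

/-- The members of the family `𝒯` that contain `s`. -/
def signature [DecidableEq S] (𝒯 : Finset (Finset S)) (s : S) : Finset (Finset S) :=
  𝒯.filter (s ∈ ·)

theorem mem_signature [DecidableEq S] {𝒯 : Finset (Finset S)} {s : S} {P : Finset S} :
    P ∈ signature 𝒯 s ↔ P ∈ 𝒯 ∧ s ∈ P := Finset.mem_filter

/-- The members containing `s` form a chain with a least element `P`. The elements with the
signature of `s` are those of `P` outside every member that lies in `P` and avoids `s`, so the sum
is a difference of two integers. -/
theorem IsLaminar.isInt_sum_signature [Fintype S] [DecidableEq S] {x : S → ℝ}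
    {𝒯 : Finset (Finset S)} (hlam : IsLaminar (𝒯 : Set (Finset S)))
    (hint : ∀ Q ∈ 𝒯, IsInt (∑ s ∈ Q, x s)) (s : S) (hs : (signature 𝒯 s).Nonempty) :
    IsInt (∑ y with signature 𝒯 y = signature 𝒯 s, x y) := by
  classical
  obtain ⟨P, hP, hmin⟩ := Finset.exists_minimal hs
  rw [mem_signature] at hP
  have hleast : ∀ R ∈ 𝒯, s ∈ R → P ⊆ R := by
    intro R hR hsR
    rcases hlam P hP.1 R hR with h | h | h
    · exact h
    · exact hmin (mem_signature.2 ⟨hR, hsR⟩) h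
    · exact absurd hsR (Finset.disjoint_left.1 h hP.2)
  set 𝒬 := 𝒯.filter fun Q => s ∉ Q ∧ Q ⊆ P with h𝒬
  have hsub : 𝒬 ⊆ 𝒯 := Finset.filter_subset _ _
  have hUP : 𝒬.biUnion id ⊆ P := by
    intro y hy
    simp only [Finset.mem_biUnion, id, h𝒬, Finset.mem_filter] at hy
    obtain ⟨Q, ⟨-, -, h⟩, hy⟩ := hy
    exact h hy
  have heq : (Finset.univ.filter fun y => signature 𝒯 y = signature 𝒯 s) =
      P \ 𝒬.biUnion id := by
    ext y
    simp only [Finset.mem_filter, Finset.mem_univ, true_and, Finset.mem_sdiff,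
      Finset.mem_biUnion, id, h𝒬, not_exists, not_and]
    constructor
    · intro h
      refine ⟨?_, ?_⟩
      · exact (mem_signature.1 (h ▸ mem_signature.2 hP : P ∈ signature 𝒯 y)).2
      · rintro Q ⟨hQ, hsQ, -⟩ hy
        exact hsQ (mem_signature.1 (h ▸ mem_signature.2 ⟨hQ, hy⟩)).2
    · rintro ⟨hyP, hy⟩
      ext R
      rw [mem_signature, mem_signature]
      refine and_congr_right fun hR => ⟨fun hyR => ?_, fun hsR => hleast R hR hsR hyP⟩
      by_contra hsR
      rcases hlam P hP.1 R hR with h | h | h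
      · exact hsR (h hP.2)
      · exact hy R ⟨hR, hsR, h⟩ hyR
      · exact Finset.disjoint_left.1 h hyP hyR
  have h := Finset.sum_sdiff (f := x) hUP
  rw [heq, ← add_sub_cancel_right (∑ y ∈ P \ 𝒬.biUnion id, x y) (∑ y ∈ 𝒬.biUnion id, x y), h]
  exact (hint P hP.1).sub (IsLaminar.isInt_sum_biUnion 𝒬 (hlam.mono (by exact_mod_cast hsub))
    fun Q hQ => hint Q (hsub hQ))

/-- The signatures, with respect to the tight sets, of the elements of `T`. -/
def signatures [DecidableEq S] (𝒯 : Finset (Finset S)) (T : Finset S) :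
    Finset (Finset (Finset S)) :=
  (T.image (signature 𝒯)).erase ∅

/-- Every non-empty signature of a fractional element belongs to at least two of them. -/
theorem IsLaminar.two_mul_card_signatures_le [Fintype S] [DecidableEq S] {x : S → ℝ}
    {𝒯 : Finset (Finset S)} (hlam : IsLaminar (𝒯 : Set (Finset S)))
    (hint : ∀ Q ∈ 𝒯, IsInt (∑ s ∈ Q, x s)) {T : Finset S} (hT : ∀ s, s ∈ T ↔ ¬ IsInt (x s)) :
    2 * (signatures 𝒯 T).card ≤ (T.filter fun s => signature 𝒯 s ≠ ∅).card := by
  classical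
  rw [Finset.card_eq_sum_card_fiberwise (f := signature 𝒯) (t := signatures 𝒯 T), mul_comm,
    ← smul_eq_mul]
  · refine Finset.card_nsmul_le_sum _ _ _ fun σ hσ => ?_
    rw [signatures, Finset.mem_erase, Finset.mem_image] at hσ
    obtain ⟨hne, s, hs, rfl⟩ := hσ
    -- If `s` were the only fractional element of its class, `x s` would be the integral class sum
    -- minus integers.
    by_contra hlt
    have hmem : s ∈ (T.filter fun s => signature 𝒯 s ≠ ∅).filter
        fun y => signature 𝒯 y = signature 𝒯 s := by simp [hs, hne]
    have hone := Finset.card_le_one.1 (Nat.lt_succ_iff.1 (not_le.1 hlt))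
    have hI := hlam.isInt_sum_signature hint s (Finset.nonempty_iff_ne_empty.2 hne)
    rw [← Finset.add_sum_erase _ _ (a := s) (by simp)] at hI
    have hrest : IsInt (∑ y ∈ (Finset.univ.filter
        fun y => signature 𝒯 y = signature 𝒯 s).erase s, x y) := by
      refine IsInt.sum fun y hy => ?_
      by_contra hy'
      rw [Finset.mem_erase, Finset.mem_filter] at hy
      refine hy.1 (hone y ?_ s hmem)
      simp only [Finset.mem_filter]
      exact ⟨⟨(hT y).2 hy', hy.2.2 ▸ hne⟩, hy.2.2⟩
    refine (hT s).1 hs ?_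
    have := hI.sub hrest
    rwa [add_sub_cancel_right] at this
  · intro s hs
    simp only [Finset.coe_filter, Set.mem_ofPred_eq] at hs
    simp only [signatures, Finset.coe_erase, Finset.coe_image, Set.mem_sdiff, Set.mem_image,
      Set.mem_singleton_iff]
    exact ⟨⟨s, hs.1, rfl⟩, hs.2⟩

/-- Within `T`, a member of `𝒯` is a disjoint union of signature classes. Hence one equation per
class is enough, and the classes, unlike the members, can be bounded in number by `T.card / 2`. -/
theorem sum_eq_zero_of_sum_signature_eq_zero [Fintype S] [DecidableEq S] {d : S → ℝ}
    {𝒯 : Finset (Finset S)} {T : Finset S} (hdT : ∀ s, s ∉ T → d s = 0)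
    (hd : ∀ σ ∈ signatures 𝒯 T, ∑ s ∈ T with signature 𝒯 s = σ, d s = 0)
    {P : Finset S} (hP : P ∈ 𝒯) : ∑ s ∈ P, d s = 0 := by
  classical
  have h1 : ∑ s ∈ P, d s = ∑ s ∈ T.filter (· ∈ P), d s := by
    symm
    apply Finset.sum_subset_zero_on_sdiff
    · intro s hs
      exact (Finset.mem_filter.1 hs).2
    · intro s hs
      rw [Finset.mem_sdiff, Finset.mem_filter] at hs
      exact hdT s fun h => hs.2 ⟨h, hs.1⟩
    · intros; rfl
  rw [h1, ← Finset.sum_fiberwise_of_maps_to (t := signatures 𝒯 T) (g := signature 𝒯)]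
  · refine Finset.sum_eq_zero fun σ hσ => ?_
    by_cases hPσ : P ∈ σ
    · rw [← hd σ hσ]
      refine Finset.sum_congr ?_ fun _ _ => rfl
      ext s
      simp only [Finset.mem_filter]
      constructor
      · rintro ⟨⟨h, -⟩, h'⟩; exact ⟨h, h'⟩
      · rintro ⟨h, rfl⟩; exact ⟨⟨h, (mem_signature.1 hPσ).2⟩, rfl⟩
    · refine Finset.sum_eq_zero fun s hs => ?_
      simp only [Finset.mem_filter] at hs
      exact absurd (hs.2 ▸ mem_signature.2 ⟨hP, hs.1.2⟩) hPσ
  · intro s hs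
    rw [Finset.mem_filter] at hs
    rw [signatures, Finset.mem_erase]
    exact ⟨Finset.ne_empty_of_mem (mem_signature.2 ⟨hP, hs.2⟩), Finset.mem_image_of_mem _ hs.1⟩

/-- A nonzero direction along which all the integral sums over members of two laminar families
stay fixed. -/
theorem exists_direction [Fintype S] [DecidableEq S] {x : S → ℝ}
    {𝒜 ℬ : Finset (Finset S)} (hA : IsLaminar (𝒜 : Set (Finset S)))
    (hB : IsLaminar (ℬ : Set (Finset S)))
    (hAint : ∀ Q ∈ 𝒜, IsInt (∑ s ∈ Q, x s)) (hBint : ∀ Q ∈ ℬ, IsInt (∑ s ∈ Q, x s))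
    (hx : ∃ s, ¬ IsInt (x s)) :
    ∃ d : S → ℝ, d ≠ 0 ∧ (∀ s, IsInt (x s) → d s = 0) ∧
      (∀ P ∈ 𝒜, ∑ s ∈ P, d s = 0) ∧ ∀ P ∈ ℬ, ∑ s ∈ P, d s = 0 := by
  classical
  set T : Finset S := Finset.univ.filter fun s => ¬ IsInt (x s) with hTdef
  have hT : ∀ s, s ∈ T ↔ ¬ IsInt (x s) := by simp [hTdef]
  let ext0 : (T → ℝ) → S → ℝ := fun d s => if h : s ∈ T then d ⟨s, h⟩ else 0
  let L : (T → ℝ) →ₗ[ℝ] ((signatures 𝒜 T → ℝ) × (signatures ℬ T → ℝ)) :=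
    { toFun := fun d => (fun σ => ∑ s ∈ T with signature 𝒜 s = σ, ext0 d s,
        fun σ => ∑ s ∈ T with signature ℬ s = σ, ext0 d s)
      map_add' := by
        intro a b
        have : ∀ s, ext0 (a + b) s = ext0 a s + ext0 b s := by
          intro s; by_cases h : s ∈ T <;> simp [ext0, h]
        ext σ <;> simp [this, Finset.sum_add_distrib]
      map_smul' := by
        intro r a
        have : ∀ s, ext0 (r • a) s = r * ext0 a s := by
          intro s; by_cases h : s ∈ T <;> simp [ext0, h]
        ext σ <;> simp [this, Finset.mul_sum] }
  -- Each family gives at most `T.card / 2` equations, so injectivity could only occur with as many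
  -- equations as unknowns. In that case both families' classes cover `T`, and the equations of
  -- either family add up to the sum over `T`: a linear dependence.
  have hL : ¬ Function.Injective L := by
    intro hinj
    have hcA := hA.two_mul_card_signatures_le hAint hT
    have hcB := hB.two_mul_card_signatures_le hBint hT
    have hfA := Finset.card_filter_le T fun s => signature 𝒜 s ≠ ∅
    have hfB := Finset.card_filter_le T fun s => signature ℬ s ≠ ∅
    have hdim := LinearMap.finrank_le_finrank_of_injective hinj
    simp only [Module.finrank_prod, Module.finrank_fintype_fun_eq_card, Fintype.card_coe]
      at hdim
    have hTpos : 0 < T.card := by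
      obtain ⟨s, hs⟩ := hx
      exact Finset.card_pos.2 ⟨s, (hT s).2 hs⟩
    have hsurj : Function.Surjective L := by
      refine (LinearMap.injective_iff_surjective_of_finrank_eq_finrank ?_).1 hinj
      simp only [Module.finrank_prod, Module.finrank_fintype_fun_eq_card, Fintype.card_coe]
      omega
    have hallA : T.filter (fun s => signature 𝒜 s ≠ ∅) = T :=
      Finset.eq_of_subset_of_card_le (Finset.filter_subset _ _) (by omega)
    have hallB : T.filter (fun s => signature ℬ s ≠ ∅) = T :=
      Finset.eq_of_subset_of_card_le (Finset.filter_subset _ _) (by omega)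
    have htotal : ∀ 𝒯 : Finset (Finset S), T.filter (fun s => signature 𝒯 s ≠ ∅) = T →
        ∀ d : S → ℝ, ∑ σ : signatures 𝒯 T, ∑ s ∈ T with signature 𝒯 s = σ, d s =
          ∑ s ∈ T, d s := by
      intro 𝒯 h𝒯 d
      rw [Finset.sum_coe_sort (signatures 𝒯 T)
        fun σ => ∑ s ∈ T with signature 𝒯 s = σ, d s]
      refine Finset.sum_fiberwise_of_maps_to (fun s hs => ?_) _
      rw [signatures, Finset.mem_erase]
      rw [← h𝒯, Finset.mem_filter] at hs
      exact ⟨hs.2, Finset.mem_image_of_mem _ hs.1⟩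
    -- A preimage of `(1, 0)` makes the sum over `T` equal both to the number of classes of `𝒜` and
    -- to `0`. Then `𝒜` has no classes, while those of `ℬ` number at most half of `T.card`.
    obtain ⟨d, hd⟩ := hsurj (fun _ => 1, fun _ => 0)
    have hdA := htotal 𝒜 hallA (ext0 d)
    have hdB := htotal ℬ hallB (ext0 d)
    have e1 : ∀ σ : signatures 𝒜 T, ∑ s ∈ T with signature 𝒜 s = σ, ext0 d s = 1 :=
      fun σ => congrFun (congrArg Prod.fst hd) σ
    have e2 : ∀ σ : signatures ℬ T, ∑ s ∈ T with signature ℬ s = σ, ext0 d s = 0 :=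
      fun σ => congrFun (congrArg Prod.snd hd) σ
    simp only [e1, e2, Finset.sum_const_zero] at hdA hdB
    rw [← hdB] at hdA
    simp only [Finset.sum_const, Finset.card_univ, Fintype.card_coe, nsmul_eq_mul, mul_one,
      Nat.cast_eq_zero] at hdA
    omega
  rw [← LinearMap.ker_eq_bot, Submodule.eq_bot_iff] at hL
  push Not at hL
  obtain ⟨d, hd, hd0⟩ := hL
  rw [LinearMap.mem_ker] at hd
  have hext : ∀ s, s ∉ T → ext0 d s = 0 := fun s hs => by simp [ext0, hs]
  refine ⟨ext0 d, fun h => hd0 ?_, fun s hs => hext s fun h => (hT s).1 h hs,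
    fun P hP => sum_eq_zero_of_sum_signature_eq_zero hext (fun σ hσ => ?_) hP,
    fun P hP => sum_eq_zero_of_sum_signature_eq_zero hext (fun σ hσ => ?_) hP⟩
  · ext ⟨s, hs⟩
    have := congrFun h s
    simpa [ext0, hs] using this
  · exact congrFun (congrArg Prod.fst hd) ⟨σ, hσ⟩
  · exact congrFun (congrArg Prod.snd hd) ⟨σ, hσ⟩

/-- Moving finitely many real numbers `x i` with speeds `d i`, not all zero, one can stop at the
first moment when one of the moving numbers reaches an integer. -/
theorem exists_step {ι : Type*} (I : Finset ι) (x d : ι → ℝ)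
    (hne : ∃ i ∈ I, d i ≠ 0) (hint : ∀ i ∈ I, IsInt (x i) → d i = 0) :
    ∃ t : ℝ, (∀ i ∈ I, FairShare (x i + t * d i) (x i)) ∧
      ∃ i ∈ I, ¬ IsInt (x i) ∧ IsInt (x i + t * d i) := by
  classical
  -- `goal i` is the integer that `x i` is heading for, and `τ i` is its arrival time when `d i ≠
  -- 0`.
  let goal : ι → ℝ := fun i => if 0 < d i then ⌈x i⌉ else ⌊x i⌋
  let τ : ι → ℝ := fun i => (goal i - x i) / d i
  have hτ : ∀ i, 0 ≤ τ i := by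
    intro i
    by_cases h : 0 < d i
    · simp only [τ, goal, h, if_true]
      exact div_nonneg (by linarith [Int.le_ceil (x i)]) h.le
    · simp only [τ, goal, h, if_false]
      exact div_nonneg_of_nonpos (by linarith [Int.floor_le (x i)]) (not_lt.1 h)
  obtain ⟨i₀, hi₀, hi₀'⟩ := hne
  obtain ⟨m, hm, hmin⟩ := (I.filter fun i => d i ≠ 0).exists_min_image τ
    ⟨i₀, by simp [hi₀, hi₀']⟩
  rw [Finset.mem_filter] at hm
  refine ⟨τ m, fun i hi => ?_, m, hm.1, fun h => hm.2 (hint m hm.1 h), ?_⟩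
  · have hf := Int.floor_le (x i)
    have hc := Int.le_ceil (x i)
    rcases lt_trichotomy (d i) 0 with h | h | h
    · have hle := hmin i (by simp [hi, h.ne])
      have hg : goal i = ⌊x i⌋ := by simp [goal, h.le.not_gt]
      have he : τ i * d i = ⌊x i⌋ - x i := by
        simp only [τ, hg]
        rw [div_mul_cancel₀ _ h.ne]
      constructor <;> nlinarith [hτ m]
    · rw [h, mul_zero, add_zero]
      exact ⟨hf, hc⟩
    · have hle := hmin i (by simp [hi, h.ne'])
      have hg : goal i = ⌈x i⌉ := by simp [goal, h]
      have he : τ i * d i = ⌈x i⌉ - x i := by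
        simp only [τ, hg]
        rw [div_mul_cancel₀ _ h.ne']
      constructor <;> nlinarith [hτ m]
  · have he : x m + τ m * d m = goal m := by
      simp only [τ]
      rw [div_mul_cancel₀ _ hm.2]
      ring
    rw [he]
    by_cases h : 0 < d m
    · exact ⟨⌈x m⌉, by simp [goal, h]⟩
    · exact ⟨⌊x m⌋, by simp [goal, h]⟩

theorem FairShare.refl (x : ℝ) : FairShare x x := ⟨Int.floor_le x, Int.le_ceil x⟩

/-- The floor and ceiling of `z` are integers, so an interval between them that contains `y` also
contains the floor and ceiling of `y`. -/
theorem FairShare.trans {x y z : ℝ} (h₁ : FairShare x y) (h₂ : FairShare y z) :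
    FairShare x z :=
  ⟨le_trans (by exact_mod_cast Int.le_floor.2 h₂.1) h₁.1,
    le_trans h₁.2 (by exact_mod_cast Int.ceil_le.2 h₂.2)⟩

theorem FairShare.isInt {x y : ℝ} (h : FairShare x y) (hy : IsInt y) : x = y := by
  obtain ⟨z, rfl⟩ := hy
  have h1 := h.1
  have h2 := h.2
  rw [Int.floor_intCast] at h1
  rw [Int.ceil_intCast] at h2
  exact le_antisymm h2 h1

/-- Simultaneous rounding for two laminar families. -/
theorem exists_rounding [Fintype S] {𝒜 ℬ : Finset (Finset S)}
    (hA : IsLaminar (𝒜 : Set (Finset S))) (hB : IsLaminar (ℬ : Set (Finset S))) (x : S → ℝ) :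
    ∃ z : S → ℝ, (∀ s, IsInt (z s)) ∧ (∀ s, FairShare (z s) (x s)) ∧
      (∀ P ∈ 𝒜, FairShare (∑ s ∈ P, z s) (∑ s ∈ P, x s)) ∧
      ∀ P ∈ ℬ, FairShare (∑ s ∈ P, z s) (∑ s ∈ P, x s) := by
  classical
  -- Singletons are included so that individual values are rounded too and a nonzero direction moves
  -- some sum. The induction is on the number of sets in `I` with fractional sum: integral sums stay
  -- put, and each step makes another one integral.
  set I : Finset (Finset S) := 𝒜 ∪ ℬ ∪ Finset.univ.image (fun s : S => ({s} : Finset S)) with hI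
  suffices h : ∃ z : S → ℝ, (∀ s, IsInt (z s)) ∧
      ∀ P ∈ I, FairShare (∑ s ∈ P, z s) (∑ s ∈ P, x s) by
    obtain ⟨z, hz, h⟩ := h
    refine ⟨z, hz, fun s => ?_, fun P hP => h P (by simp [hI, hP]),
      fun P hP => h P (by simp [hI, hP])⟩
    simpa using h {s} (by simp [hI])
  induction hn : (I.filter fun P => ¬ IsInt (∑ s ∈ P, x s)).card using Nat.strong_induction_on
    generalizing x with
  | _ n ih =>
    by_cases hx : ∃ s, ¬ IsInt (x s)
    swap
    · push Not at hx
      exact ⟨x, hx, fun P _ => FairShare.refl _⟩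
    obtain ⟨d, hd0, hd1, hdA, hdB⟩ := exists_direction (x := x)
      (𝒜 := 𝒜.filter fun P => IsInt (∑ s ∈ P, x s)) (ℬ := ℬ.filter fun P => IsInt (∑ s ∈ P, x s))
      (hA.mono (by exact_mod_cast Finset.filter_subset _ _))
      (hB.mono (by exact_mod_cast Finset.filter_subset _ _))
      (fun Q hQ => (Finset.mem_filter.1 hQ).2) (fun Q hQ => (Finset.mem_filter.1 hQ).2) hx
    obtain ⟨t, ht, P₀, hP₀, hP₀x, hP₀'⟩ := exists_step I (fun P => ∑ s ∈ P, x s)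
      (fun P => ∑ s ∈ P, d s) (by
        obtain ⟨s, hs⟩ := Function.ne_iff.1 hd0
        exact ⟨{s}, by simp [hI], by simpa using hs⟩) (by
        intro P hP hPx
        simp only [hI, Finset.mem_union, Finset.mem_image, Finset.mem_univ, true_and] at hP
        rcases hP with (hP | hP) | ⟨s, rfl⟩
        · exact hdA P (Finset.mem_filter.2 ⟨hP, hPx⟩)
        · exact hdB P (Finset.mem_filter.2 ⟨hP, hPx⟩)
        · rw [Finset.sum_singleton] at hPx ⊢
          exact hd1 s hPx)
    have hsum : ∀ P : Finset S, ∑ s ∈ P, (x s + t * d s) = ∑ s ∈ P, x s + t * ∑ s ∈ P, d s := by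
      intro P
      rw [Finset.sum_add_distrib, Finset.mul_sum]
    have hlt : (I.filter fun P => ¬ IsInt (∑ s ∈ P, (x s + t * d s))).card < n := by
      rw [← hn]
      refine Finset.card_lt_card ((Finset.ssubset_iff_of_subset ?_).2 ⟨P₀, ?_, ?_⟩)
      · intro P hP
        rw [Finset.mem_filter] at hP ⊢
        refine ⟨hP.1, fun h => hP.2 ?_⟩
        rw [hsum, (ht P hP.1).isInt h]
        exact h
      · exact Finset.mem_filter.2 ⟨hP₀, hP₀x⟩
      · simp only [Finset.mem_filter, hsum, not_and, not_not]
        exact fun _ => hP₀'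
    obtain ⟨z, hz, hzI⟩ := ih _ hlt (fun s => x s + t * d s) rfl
    refine ⟨z, hz, fun P hP => (hzI P hP).trans ?_⟩
    rw [hsum]
    exact ht P hP

end Rounding

theorem IsLaminar.preimage {α β : Type*} {𝒦 : Set (Set β)} (h : IsLaminar 𝒦) (f : α → β) :
    IsLaminar ((f ⁻¹' ·) '' 𝒦) := by
  rintro _ ⟨P, hP, rfl⟩ _ ⟨Q, hQ, rfl⟩
  rcases h P hP Q hQ with h | h | h
  · exact Or.inl (Set.preimage_mono h)
  · exact Or.inr (Or.inl (Set.preimage_mono h))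
  · exact Or.inr (Or.inr (h.preimage f))

/-! ### Fair subsets. -/

open Classical in
/-- **Nash-Williams' lemma** on two laminar families: some subset of `Z` takes a fair share, one
`n`-th, of every member. -/
theorem exists_fair_subset {S : Type*} [Finite S] {𝒜 ℬ : Set (Set S)} (hA : IsLaminar 𝒜)
    (hB : IsLaminar ℬ) (Z : Set S) {n : ℕ} (hn : 0 < n) :
    ∃ A ⊆ Z, (∀ P ∈ 𝒜, FairShare (A ∩ P).ncard ((Z ∩ P).ncard / n : ℝ)) ∧
      ∀ P ∈ ℬ, FairShare (A ∩ P).ncard ((Z ∩ P).ncard / n : ℝ) := by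
  have := Fintype.ofFinite S
  have hcoe : ∀ {𝒦 : Set (Set S)}, IsLaminar 𝒦 →
      IsLaminar ((Finset.univ.filter fun P : Finset S => (P : Set S) ∈ 𝒦 :
        Finset (Finset S)) : Set (Finset S)) := by
    intro 𝒦 h P hP Q hQ
    simp only [Finset.coe_filter, Finset.mem_univ, true_and, Set.mem_ofPred_eq] at hP hQ
    rcases h _ hP _ hQ with h | h | h
    · exact Or.inl (by exact_mod_cast h)
    · exact Or.inr (Or.inl (by exact_mod_cast h))
    · exact Or.inr (Or.inr (by exact_mod_cast h))
  -- Round the weight `1 / n` on `Z`, and `0` elsewhere. The rounded weights are `0` or `1`, hence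
  -- the indicator of a subset of `Z`.
  obtain ⟨z, hz, hs, hA', hB'⟩ := exists_rounding (hcoe hA) (hcoe hB)
    (fun s => if s ∈ Z then (1 / n : ℝ) else 0)
  have hz0 : ∀ s, s ∉ Z → z s = 0 := fun s h => by
    have := (hs s).isInt (by simp only [h, if_false]; exact ⟨0, by simp⟩)
    simpa [h] using this
  have hz01 : ∀ s, z s = if z s = 1 then (1 : ℝ) else 0 := by
    intro s
    by_cases h : s ∈ Z
    · obtain ⟨k, hk⟩ := hz s
      have h1 := (hs s).1
      have h2 := (hs s).2
      simp only [h, if_true, ← hk] at h1 h2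
      have h0 : (0 : ℤ) ≤ k :=
        le_trans (Int.floor_nonneg.2 (by positivity : (0 : ℝ) ≤ 1 / n)) (by exact_mod_cast h1)
      have h1' : k ≤ 1 := by
        refine le_trans (by exact_mod_cast h2) (Int.ceil_le.2 ?_)
        rw [Int.cast_one, div_le_one (by exact_mod_cast hn)]
        exact_mod_cast hn
      rw [← hk]
      interval_cases k <;> norm_num
    · simp [hz0 s h]
  have hsumA : ∀ P : Set S, ∑ s ∈ P.toFinset, z s = (({s | z s = 1} ∩ P).ncard : ℝ) := by
    intro P
    rw [Finset.sum_congr rfl fun s _ => hz01 s, Finset.sum_boole,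
      Set.ncard_eq_toFinset_card']
    congr 2
    ext s
    simp [and_comm]
  have hsumZ : ∀ P : Set S, ∑ s ∈ P.toFinset, (if s ∈ Z then (1 / n : ℝ) else 0) =
      ((Z ∩ P).ncard / n : ℝ) := by
    intro P
    rw [← Finset.sum_filter, Finset.sum_const, nsmul_eq_mul, mul_one_div,
      Set.ncard_eq_toFinset_card']
    congr 3
    ext s
    simp [and_comm]
  refine ⟨{s | z s = 1}, fun s h => ?_, fun P hP => ?_, fun P hP => ?_⟩
  · by_contra h'
    have h : z s = 1 := h
    rw [hz0 s h'] at h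
    exact zero_ne_one h
  · rw [← hsumA, ← hsumZ]
    exact hA' _ (by simpa using hP)
  · rw [← hsumA, ← hsumZ]
    exact hB' _ (by simpa using hP)

/-! ### Arithmetic of fair shares. -/

theorem FairShare.sub_left {a y : ℝ} (h : FairShare a y) (N : ℕ) : FairShare (N - a) (N - y) := by
  have e1 : ⌊(N : ℝ) - y⌋ = N - ⌈y⌉ := by
    rw [sub_eq_add_neg, Int.floor_natCast_add, Int.floor_neg, sub_eq_add_neg]
  have e2 : ⌈(N : ℝ) - y⌉ = N - ⌊y⌋ := by
    rw [sub_eq_add_neg, Int.ceil_natCast_add, Int.ceil_neg, sub_eq_add_neg]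
  constructor
  · rw [e1]
    push_cast
    linarith [h.2]
  · rw [e2]
    push_cast
    linarith [h.1]

/-- `K⌊y⌋` and `K⌈y⌉` are integers enclosing `yK`, hence also its floor and ceiling. -/
theorem FairShare.div_of_mul {a y : ℝ} {K : ℕ} (hK : 0 < K) (h : FairShare a (y * K)) :
    FairShare (a / K) y := by
  have hK' : (0 : ℝ) < K := by exact_mod_cast hK
  constructor
  · rw [le_div_iff₀ hK']
    refine le_trans ?_ h.1
    have : ⌊y⌋ * (K : ℤ) ≤ ⌊y * K⌋ := by
      rw [Int.le_floor]
      push_cast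
      exact mul_le_mul_of_nonneg_right (Int.floor_le y) hK'.le
    exact_mod_cast this
  · rw [div_le_iff₀ hK']
    refine le_trans h.2 ?_
    have : ⌈y * K⌉ ≤ ⌈y⌉ * (K : ℤ) := by
      rw [Int.ceil_le]
      push_cast
      exact mul_le_mul_of_nonneg_right (Int.le_ceil y) hK'.le
    exact_mod_cast this

/-- Passing from `n` copies of a vertex to one copy and `n - 1` remaining ones: the edges that
use the separated copy. -/
theorem FairShare.div_choose_succ {a M : ℝ} {n m R : ℕ} (hm : m ≤ n) (hR : 0 < R)
    (h : FairShare a ((m + 1) * M / (n + 1))) :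
    FairShare (a / ((n.choose m : ℝ) * R)) (M / (((n + 1).choose (m + 1) : ℝ) * R)) := by
  have hc := Nat.choose_pos hm
  have hc' : 0 < (n + 1).choose (m + 1) := Nat.choose_pos (by omega)
  have key := Nat.add_one_mul_choose_eq n m
  have := FairShare.div_of_mul (a := a) (y := M / (((n + 1).choose (m + 1) : ℝ) * R))
    (K := n.choose m * R) (by positivity) ?_
  · simpa using this
  · convert h using 1
    have hc'' : ((n + 1).choose (m + 1) : ℝ) ≠ 0 := by exact_mod_cast hc'.ne'
    have hR' : (R : ℝ) ≠ 0 := by exact_mod_cast hR.ne'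
    have key' : ((n : ℝ) + 1) * n.choose m = (n + 1).choose (m + 1) * (m + 1) := by
      exact_mod_cast key
    have hn : ((n : ℝ) + 1) ≠ 0 := by positivity
    push_cast
    field_simp
    linear_combination M * key'

/-- Passing from `n` copies of a vertex to one copy and `n - 1` remaining ones: the edges that
avoid the separated copy. -/
theorem FairShare.sub_div_choose {a : ℝ} {M n m R : ℕ} (hm : m ≤ n) (hR : 0 < R)
    (h : FairShare a (m * M / (n + 1))) :
    FairShare ((M - a) / ((n.choose m : ℝ) * R)) (M / (((n + 1).choose m : ℝ) * R)) := by
  have hc := Nat.choose_pos hm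
  have hc' : 0 < (n + 1).choose m := Nat.choose_pos (by omega)
  have key := Nat.choose_mul_succ_eq n m
  have := FairShare.div_of_mul (a := M - a) (y := M / (((n + 1).choose m : ℝ) * R))
    (K := n.choose m * R) (by positivity) ?_
  · simpa using this
  · convert h.sub_left M using 1
    have hc'' : ((n + 1).choose m : ℝ) ≠ 0 := by exact_mod_cast hc'.ne'
    have hR' : (R : ℝ) ≠ 0 := by exact_mod_cast hR.ne'
    have key' : (n.choose m : ℝ) * (n + 1) = (n + 1).choose m * (n + 1 - m) := by
      have h1 : (n.choose m : ℤ) * (n + 1) = (n + 1).choose m * (n + 1 - m) := by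
        have := congrArg (Nat.cast : ℕ → ℤ) key
        push_cast [Nat.cast_sub (show m ≤ n + 1 by omega)] at this
        exact this
      exact_mod_cast h1
    have hn : ((n : ℝ) + 1) ≠ 0 := by positivity
    push_cast
    field_simp
    linear_combination M * key'

/-! ### Separating one copy of a vertex. -/

namespace HingeHypergraph

variable {V E H : Type*}

/-- The number of hinges at `v` that belong to edges in `D`. -/
noncomputable def degreeIn (F : HingeHypergraph V E H) (D : Set E) (v : V) : ℕ :=
  (F.hinges v ∩ F.edgeOf ⁻¹' D).ncard

/-- The number of edges in `D` that join the multiset `U`. -/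
noncomputable def multiplicityIn (F : HingeHypergraph V E H) (D : Set E) (U : Multiset V) : ℕ :=
  (F.edgesJoining U ∩ D).ncard

open Classical in
/-- The hypergraph in which the hinges in `A` are moved to a new vertex `none`. -/
noncomputable def splitOff (F : HingeHypergraph V E H) (A : Set H) :
    HingeHypergraph (Option V) E H where
  vertexOf h := if h ∈ A then none else some (F.vertexOf h)
  edgeOf := F.edgeOf
  edgeOf_surjective := F.edgeOf_surjective

variable {F : HingeHypergraph V E H} {A : Set H} {α : V}

theorem hingesAt_eq (v : V) (e : E) : F.hingesAt v e = F.hinges v ∩ F.edgeOf ⁻¹' {e} := by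
  ext h; simp [hingesAt, hinges]

theorem mem_edgesJoining {e : E} {U : Multiset V} [DecidableEq V] :
    e ∈ F.edgesJoining U ↔ ∀ v, (F.hingesAt v e).ncard = U.count v := by
  simp only [edgesJoining, Set.mem_ofPred_eq]
  refine forall_congr' fun v => ?_
  convert Iff.rfl

theorem splitOff_hinges_none : (F.splitOff A).hinges none = A := by
  classical
  ext h; simp [splitOff, hinges]

theorem splitOff_hinges_some (u : V) : (F.splitOff A).hinges (some u) = F.hinges u \ A := by
  classical
  ext h
  by_cases hh : h ∈ A <;> simp [splitOff, hinges, hh]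

theorem splitOff_edgeOf : (F.splitOff A).edgeOf = F.edgeOf := rfl

theorem splitOff_amalgamation (hA : A ⊆ F.hinges α) :
    (F.splitOff A).amalgamation (fun o => o.getD α) = F := by
  classical
  obtain ⟨f, e, hs⟩ := F
  simp only [splitOff, amalgamation, mk.injEq, and_true]
  funext h
  by_cases hh : h ∈ A
  · have : f h = α := hA hh
    simp [hh, this]
  · simp [hh]

theorem ncard_hinges_inter_splitOff [Finite H] [DecidableEq V] (hA : A ⊆ F.hinges α) (u : V)
    (K : Set H) : (F.hinges u ∩ K).ncard = ((F.splitOff A).hinges (some u) ∩ K).ncard +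
      if u = α then ((F.splitOff A).hinges none ∩ K).ncard else 0 := by
  rw [splitOff_hinges_none, splitOff_hinges_some]
  by_cases h : u = α
  · subst h
    rw [if_pos rfl, ← Set.ncard_inter_add_ncard_sdiff_eq_ncard (F.hinges u ∩ K) A, add_comm]
    congr 2
    · ext x; simp; tauto
    · ext x
      simp only [Set.mem_inter_iff]
      exact ⟨fun h => ⟨h.2, h.1.2⟩, fun h => ⟨⟨hA h.1, h.2⟩, h.1⟩⟩
  · rw [if_neg h, add_zero]
    congr 2
    ext x
    simp only [Set.mem_sdiff, iff_self_and]
    intro hx hxA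
    exact h (Eq.trans (Eq.symm hx) (hA hxA))

theorem count_map_getD [DecidableEq V] (U : Multiset (Option V)) (u : V) :
    (U.map fun o => o.getD α).count u =
      U.count (some u) + if u = α then U.count none else 0 := by
  induction U using Multiset.induction_on with
  | empty => simp
  | cons o U ih =>
    rw [Multiset.map_cons, Multiset.count_cons, ih]
    cases o with
    | none => by_cases h : u = α <;> simp [h, add_assoc]
    | some v =>
      by_cases h : u = α <;> by_cases h' : u = v <;> simp [h, h', Multiset.count_cons] <;>
        split_ifs <;> omega

/-- Only hinges at `α` move, so the numbers of hinges of `e` at `α` before the splitting and in `A`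
determine the number left at `α`. -/
theorem mem_splitOff_edgesJoining [Finite H] (hA : A ⊆ F.hinges α) {U : Multiset (Option V)}
    {e : E} [DecidableEq V] : e ∈ (F.splitOff A).edgesJoining U ↔
      e ∈ F.edgesJoining (U.map fun o => o.getD α) ∧
        (A ∩ F.edgeOf ⁻¹' {e}).ncard = U.count none := by
  have hsum := fun u => ncard_hinges_inter_splitOff hA u (F.edgeOf ⁻¹' {e})
  rw [mem_edgesJoining, mem_edgesJoining]
  simp only [hingesAt_eq, splitOff_edgeOf, count_map_getD, hsum]
  constructor
  · intro h
    exact ⟨fun u => by rw [h (some u), h none], by rw [← h none, splitOff_hinges_none]⟩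
  · rintro ⟨h, h'⟩ (_ | u)
    · rw [← h', splitOff_hinges_none]
    · have := h u
      rw [← h', splitOff_hinges_none] at this
      split_ifs at this <;> omega

/-- Every edge joining `U` has exactly `U.count v` hinges at `v`. This translates between counts of
edges and counts of hinges. -/
theorem ncard_hinges_inter_preimage_edgesJoining [Finite E] [Finite H] [DecidableEq V]
    (v : V) (U : Multiset V) (D : Set E) :
    (F.hinges v ∩ F.edgeOf ⁻¹' (F.edgesJoining U ∩ D)).ncard =
      U.count v * F.multiplicityIn D U := by
  classical
  have := Fintype.ofFinite E
  have := Fintype.ofFinite H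
  rw [multiplicityIn, Set.ncard_eq_toFinset_card', Set.ncard_eq_toFinset_card',
    Finset.card_eq_sum_card_fiberwise (f := F.edgeOf) (t := (F.edgesJoining U ∩ D).toFinset)]
  · rw [Finset.sum_congr rfl (g := fun _ => U.count v), Finset.sum_const, smul_eq_mul, mul_comm]
    intro e he
    rw [Set.mem_toFinset] at he
    rw [← mem_edgesJoining.1 he.1 v, hingesAt_eq, Set.ncard_eq_toFinset_card']
    congr 1
    ext h
    simp only [Finset.mem_filter, Set.mem_toFinset, Set.mem_inter_iff, Set.mem_preimage,
      Set.mem_singleton_iff]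
    exact ⟨fun h => ⟨h.1.1, h.2⟩, fun h => ⟨⟨h.1, h.2 ▸ he⟩, h.2⟩⟩
  · intro h hh
    simp only [Set.coe_toFinset] at hh ⊢
    exact hh.2

/-- The number function of the detachment that separates one copy of `α`. -/
def splitFun [DecidableEq V] (g : V → ℕ) (α : V) : Option V → ℕ :=
  fun o => o.elim 1 (Function.update g α (g α - 1))

theorem ncard_edges_meeting [Finite E] [Finite H]
    (hone : ∀ e, (A ∩ F.edgeOf ⁻¹' {e}).ncard ≤ 1) (X : Set E) :
    {e ∈ X | (A ∩ F.edgeOf ⁻¹' {e}).ncard = 1}.ncard = (A ∩ F.edgeOf ⁻¹' X).ncard := by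
  rw [← Set.InjOn.ncard_image (f := F.edgeOf) (s := A ∩ F.edgeOf ⁻¹' X)]
  · congr 1
    ext e
    simp only [Set.mem_ofPred_eq, Set.mem_image, Set.mem_inter_iff, Set.mem_preimage]
    constructor
    · rintro ⟨he, h1⟩
      obtain ⟨h, hh⟩ := Set.ncard_eq_one.1 h1
      have hm : h ∈ A ∩ F.edgeOf ⁻¹' {e} := hh ▸ rfl
      have h2 : F.edgeOf h = e := hm.2
      exact ⟨h, ⟨hm.1, h2 ▸ he⟩, h2⟩
    · rintro ⟨h, ⟨hhA, hX⟩, rfl⟩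
      refine ⟨hX, le_antisymm (hone _) ?_⟩
      exact (Set.ncard_pos (Set.toFinite _)).2 ⟨h, hhA, rfl⟩
  · intro a ha b hb hab
    exact (Set.ncard_le_one (Set.toFinite _)).1 (hone (F.edgeOf b)) a ⟨ha.1, hab⟩ b ⟨hb.1, rfl⟩

/-- The new vertex gets its share directly. The remainder at `α` is fair for `(g α - 1) / g α` of
the old degree, and is then divided by `g α - 1`. -/
theorem splitOff_degreeIn [Finite H] [DecidableEq V] (hA : A ⊆ F.hinges α)
    {g : V → ℕ} (hg : 1 < g α) {D : Set E}
    (h : FairShare (A ∩ F.edgeOf ⁻¹' D).ncard (F.degreeIn D α / g α : ℝ)) (o : Option V) :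
    FairShare ((F.splitOff A).degreeIn D o / splitFun g α o : ℝ)
      (F.degreeIn D (o.getD α) / g (o.getD α)) := by
  cases o with
  | none =>
    simpa [degreeIn, splitFun, splitOff_hinges_none, splitOff_edgeOf] using h
  | some u =>
    have hsum : F.degreeIn D u = (F.splitOff A).degreeIn D (some u) +
      if u = α then (F.splitOff A).degreeIn D none else 0 :=
      ncard_hinges_inter_splitOff hA u (F.edgeOf ⁻¹' D)
    by_cases hu : u = α
    · subst hu
      obtain ⟨n, hn⟩ : ∃ n, g u = n + 1 := ⟨g u - 1, by omega⟩
      have h0 : (F.splitOff A).degreeIn D none = (A ∩ F.edgeOf ⁻¹' D).ncard := by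
        rw [degreeIn, splitOff_hinges_none, splitOff_edgeOf]
      rw [if_pos rfl, h0] at hsum
      have hsum' : ((F.splitOff A).degreeIn D (some u) : ℝ) =
          F.degreeIn D u - (A ∩ F.edgeOf ⁻¹' D).ncard := by
        rw [hsum]; push_cast; ring
      rw [hn] at h
      push_cast at h
      have hpos : (0 : ℝ) < n := by exact_mod_cast (by omega : 0 < n)
      simp only [splitFun, Option.elim, Function.update_self, Option.getD_some, hn,
        Nat.add_sub_cancel, hsum']
      refine FairShare.div_of_mul (by omega) ?_
      convert h.sub_left (F.degreeIn D u) using 1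
      push_cast
      field_simp
      ring
    · rw [if_neg hu, add_zero] at hsum
      simp only [splitFun, Option.elim, Function.update_of_ne hu, Option.getD_some, hsum]
      exact FairShare.refl _

/-- An edge joins `U` after the splitting when it joined the image of `U` before and meets `A` or
avoids it, according to whether `U` contains the new vertex. The factors of vertices other than `α`
are unchanged and are collected in `R`. -/
theorem splitOff_multiplicityIn [Fintype V] [Finite E] [Finite H] [DecidableEq V]
    (hA : A ⊆ F.hinges α) {g : V → ℕ} (hg : 1 < g α)
    (hone : ∀ e, (A ∩ F.edgeOf ⁻¹' {e}).ncard ≤ 1) {D : Set E} {U : Multiset (Option V)}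
    (hU : ∀ o, U.count o ≤ splitFun g α o)
    (h : FairShare (A ∩ F.edgeOf ⁻¹' (F.edgesJoining (U.map fun o => o.getD α) ∩ D)).ncard
      ((F.hinges α ∩ F.edgeOf ⁻¹' (F.edgesJoining (U.map fun o => o.getD α) ∩ D)).ncard /
        g α : ℝ)) :
    FairShare
      ((F.splitOff A).multiplicityIn D U / ∏ o, ((splitFun g α o).choose (U.count o) : ℝ))
      (F.multiplicityIn D (U.map fun o => o.getD α) /
        ∏ u, ((g u).choose ((U.map fun o => o.getD α).count u) : ℝ)) := by
  set U' := U.map fun o => o.getD α with hU'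
  set X := F.edgesJoining U' ∩ D with hX
  obtain ⟨n, hn⟩ : ∃ n, g α = n + 1 := ⟨g α - 1, by omega⟩
  set R : ℕ := ∏ u ∈ Finset.univ.erase α, (g u).choose (U'.count u) with hR
  have hcount : ∀ u, u ≠ α → U'.count u = U.count (some u) := by
    intro u hu
    rw [hU', count_map_getD, if_neg hu, add_zero]
  have hcountα : U'.count α = U.count (some α) + U.count none := by
    rw [hU', count_map_getD, if_pos rfl]
  have hgα : splitFun g α (some α) = n := by simp [splitFun, hn]
  have hgu : ∀ u, u ≠ α → splitFun g α (some u) = g u := fun u hu => by simp [splitFun, hu]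
  have hRpos : 0 < R := by
    refine Finset.prod_pos fun u hu => Nat.choose_pos ?_
    rw [Finset.mem_erase] at hu
    rw [hcount u hu.1, ← hgu u hu.1]
    exact hU _
  have hmn : U.count (some α) ≤ n := hgα ▸ hU (some α)
  have h0 : U.count none ≤ 1 := hU none
  have hP1 : ∏ o, ((splitFun g α o).choose (U.count o) : ℝ) =
      (n.choose (U.count (some α)) : ℝ) * R := by
    rw [Fintype.prod_option, ← Finset.mul_prod_erase _ _ (Finset.mem_univ α), hgα, hR]
    have : ((splitFun g α none).choose (U.count none) : ℝ) = 1 := by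
      have : splitFun g α none = 1 := rfl
      rw [this]
      interval_cases U.count none <;> simp
    rw [this, one_mul]
    push_cast
    congr 1
    refine Finset.prod_congr rfl fun u hu => ?_
    rw [Finset.mem_erase] at hu
    rw [hgu u hu.1, hcount u hu.1]
  have hP2 : ∏ u, ((g u).choose (U'.count u) : ℝ) =
      ((n + 1).choose (U'.count α) : ℝ) * R := by
    rw [← Finset.mul_prod_erase _ _ (Finset.mem_univ α), hn, hR]
    push_cast
    rfl
  rw [hP1, hP2]
  rw [ncard_hinges_inter_preimage_edgesJoining, hn] at h
  have hset : (F.splitOff A).edgesJoining U ∩ D =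
      {e ∈ X | (A ∩ F.edgeOf ⁻¹' {e}).ncard = U.count none} := by
    ext e
    rw [Set.mem_inter_iff, mem_splitOff_edgesJoining hA]
    simp only [hX, Set.mem_inter_iff, Set.mem_ofPred_eq]
    tauto
  have hmeet := ncard_edges_meeting (F := F) hone X
  have hcases : U.count none = 0 ∨ U.count none = 1 := by omega
  rcases hcases with hc | hc
  · have hM : (((F.splitOff A).multiplicityIn D U : ℕ) : ℝ) =
        F.multiplicityIn D U' - (A ∩ F.edgeOf ⁻¹' X).ncard := by
      rw [multiplicityIn, hset, ← hmeet, multiplicityIn, hc, eq_sub_iff_add_eq]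
      have := Set.ncard_inter_add_ncard_sdiff_eq_ncard X
        {e | (A ∩ F.edgeOf ⁻¹' {e}).ncard = 1}
      rw [← hX, ← this, add_comm]
      push_cast
      congr 3
      ext e
      have := hone e
      simp only [Set.mem_ofPred_eq, Set.mem_sdiff]
      refine and_congr_right fun _ => ?_
      omega
    rw [hc, add_zero] at hcountα
    rw [hM, hcountα]
    refine FairShare.sub_div_choose hmn hRpos ?_
    rw [← hcountα]
    push_cast at h
    exact h
  · have hM : (F.splitOff A).multiplicityIn D U = (A ∩ F.edgeOf ⁻¹' X).ncard := by
      rw [multiplicityIn, hset, ← hmeet, hc]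
    rw [hc] at hcountα
    rw [hM, hcountα]
    refine FairShare.div_choose_succ hmn hRpos ?_
    rw [hcountα] at h
    push_cast at h
    exact h

end HingeHypergraph

namespace HingeHypergraph

variable {V E H : Type*}

/-- An edge with at most `g α` hinges at `α` has share at most `1`, so at most one of them moves. If
it has exactly `g α`, the share is exactly `1`, so one does move and `g α - 1` remain. -/
theorem splitOff_isSimpleFun [Finite H] [DecidableEq V] {F : HingeHypergraph V E H} {A : Set H}
    {α : V} (hA : A ⊆ F.hinges α) {g : V → ℕ} (hgα : 1 < g α) (hg : F.IsSimpleFun g)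
    (h : ∀ e, FairShare (A ∩ F.edgeOf ⁻¹' {e}).ncard ((F.hingesAt α e).ncard / g α : ℝ)) :
    (F.splitOff A).IsSimpleFun (splitFun g α) := by
  have hone : ∀ e, (A ∩ F.edgeOf ⁻¹' {e}).ncard ≤ 1 := by
    intro e
    have h2 := (h e).2
    have : ⌈((F.hingesAt α e).ncard / g α : ℝ)⌉ ≤ 1 := by
      rw [Int.ceil_le, Int.cast_one]
      exact div_le_one_of_le₀ (by exact_mod_cast hg α e) (by positivity)
    have h3 : ((A ∩ F.edgeOf ⁻¹' {e}).ncard : ℤ) ≤ 1 := le_trans (by exact_mod_cast h2) this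
    exact_mod_cast h3
  intro o e
  rw [hingesAt_eq, splitOff_edgeOf]
  cases o with
  | none => rw [splitOff_hinges_none]; exact hone e
  | some u =>
    have hsum := ncard_hinges_inter_splitOff hA u (F.edgeOf ⁻¹' {e})
    have hge := hg u e
    rw [hingesAt_eq, hsum] at hge
    by_cases hu : u = α
    · subst hu
      simp only [splitFun, Option.elim, Function.update_self]
      rw [if_pos rfl, splitOff_hinges_none] at hge
      rcases hge.lt_or_eq with hlt | heq
      · omega
      · have h1 := (h e).1
        rw [hingesAt_eq, hsum, if_pos rfl, splitOff_hinges_none, heq, div_self (by positivity),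
          Int.floor_one] at h1
        have h1' : 1 ≤ (A ∩ F.edgeOf ⁻¹' {e}).ncard := by exact_mod_cast h1
        omega
    · simp only [splitFun, Option.elim, Function.update_of_ne hu]
      omega

/-! ### Induction over the splittings. -/

/-- The detachment `G` of `F` shares out, over the edges in `D`, degrees and multiplicities
fairly. -/
def IsFairOn {W : Type*} [Fintype V] [DecidableEq V] (G : HingeHypergraph W E H)
    (F : HingeHypergraph V E H) (Ψ : W → V) (g : V → ℕ) (D : Set E) : Prop :=
  (∀ x, FairShare (G.degreeIn D x) (F.degreeIn D (Ψ x) / g (Ψ x) : ℝ)) ∧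
    ∀ X : Finset W, FairShare (G.multiplicityIn D X.val)
      (F.multiplicityIn D (X.val.map Ψ) / ∏ u, ((g u).choose ((X.val.map Ψ).count u) : ℝ))

/-- A simple `g`-detachment that is fair over all the members of a laminar family of edge sets. -/
theorem exists_fair_detachment {V : Type u} {E : Type v} {H : Type w} [Fintype V]
    [DecidableEq V] [Finite E] [Finite H] (F : HingeHypergraph V E H) {𝒟 : Set (Set E)}
    (h𝒟 : IsLaminar 𝒟) (g : V → ℕ) (hpos : ∀ u, 0 < g u) (hg : F.IsSimpleFun g) :
    ∃ (W : Type u) (_ : Finite W) (G : HingeHypergraph W E H) (Ψ : W → V),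
      G.IsSimple ∧ G.IsDetachment F Ψ g ∧ ∀ D ∈ 𝒟, G.IsFairOn F Ψ g D := by
  classical
  -- The measure counts the copies still to be separated; a new vertex contributes `1 - 1 = 0`.
  induction hN : ∑ u, (g u - 1) using Nat.strong_induction_on generalizing V with
  | _ N ih =>
  by_cases hα : ∃ α, 1 < g α
  swap
  · have hone : g = fun _ => 1 := by
      funext u
      by_contra h
      exact hα ⟨u, by have := hpos u; omega⟩
    subst hone
    refine ⟨V, inferInstance, F, id, hg, ⟨Function.surjective_id, rfl, fun u => by simp⟩,
      fun D _ => ⟨fun x => ?_, fun X => ?_⟩⟩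
    · simpa using FairShare.refl _
    · rw [Multiset.map_id, Finset.prod_eq_one]
      · simpa using FairShare.refl _
      · intro u _
        have : X.val.count u ≤ 1 := Multiset.nodup_iff_count_le_one.1 X.nodup u
        interval_cases X.val.count u <;> simp
  obtain ⟨α, hα⟩ := hα
  -- Adding the single edges preserves laminarity and forces `A` to share out each edge fairly.
  have h𝒟' : IsLaminar (𝒟 ∪ Set.range fun e : E => ({e} : Set E)) := by
    have hs : ∀ e (Q : Set E), {e} ≤ Q ∨ Disjoint {e} Q := by
      intro e Q
      by_cases h : e ∈ Q
      · exact Or.inl (Set.singleton_subset_iff.2 h)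
      · exact Or.inr (Set.disjoint_singleton_left.2 h)
    rintro P (hP | ⟨e, rfl⟩) Q (hQ | ⟨e', rfl⟩)
    · exact h𝒟 P hP Q hQ
    · exact Or.inr ((hs e' P).imp id fun h => h.symm)
    · exact (hs e Q).imp id Or.inr
    · exact (hs e {e'}).imp id Or.inr
  -- The multiset joined by an edge is determined by the edge, so different multisets give disjoint
  -- sets.
  have hℬ : IsLaminar {K : Set E | ∃ U, ∃ D ∈ 𝒟, K = F.edgesJoining U ∩ D} := by
    rintro _ ⟨U, D, hD, rfl⟩ _ ⟨U', D', hD', rfl⟩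
    by_cases hU : U = U'
    · subst hU
      rcases h𝒟 D hD D' hD' with h | h | h
      · exact Or.inl (Set.inter_subset_inter_right _ h)
      · exact Or.inr (Or.inl (Set.inter_subset_inter_right _ h))
      · exact Or.inr (Or.inr (h.mono Set.inter_subset_right Set.inter_subset_right))
    · refine Or.inr (Or.inr (Set.disjoint_left.2 fun e he he' => hU ?_))
      ext v
      rw [← mem_edgesJoining.1 he.1 v, mem_edgesJoining.1 he'.1 v]
  obtain ⟨A, hA, hA1, hA2⟩ := exists_fair_subset (h𝒟'.preimage F.edgeOf) (hℬ.preimage F.edgeOf)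
    (F.hinges α) (hpos α)
  have hAe : ∀ e, FairShare (A ∩ F.edgeOf ⁻¹' {e}).ncard
      ((F.hingesAt α e).ncard / g α : ℝ) := by
    intro e
    rw [hingesAt_eq]
    exact hA1 _ ⟨{e}, Or.inr ⟨e, rfl⟩, rfl⟩
  have hsimple := splitOff_isSimpleFun hA hα hg hAe
  have hone : ∀ e, (A ∩ F.edgeOf ⁻¹' {e}).ncard ≤ 1 := by
    intro e
    have := hsimple none e
    rwa [hingesAt_eq, splitOff_hinges_none] at this
  have hlt : ∑ o, (splitFun g α o - 1) < N := by
    rw [← hN, Fintype.sum_option]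
    simp only [splitFun, Option.elim, Nat.sub_self, zero_add]
    refine Finset.sum_lt_sum (fun u _ => ?_) ⟨α, Finset.mem_univ α, ?_⟩
    · by_cases h : u = α
      · subst h; simp
      · simp [h]
    · simp; omega
  have hpos' : ∀ o, 0 < splitFun g α o := by
    rintro (_ | u)
    · exact Nat.one_pos
    · by_cases h : u = α
      · subst h; simpa [splitFun] using hα
      · simpa [splitFun, h] using hpos u
  obtain ⟨W, hW, G, Ψ, hGs, ⟨hΨ, hGF, hfib⟩, hfair⟩ :=
    ih _ hlt (F.splitOff A) (splitFun g α) hpos' hsimple rfl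
  refine ⟨W, hW, G, fun x => (Ψ x).getD α, hGs, ⟨?_, ?_, ?_⟩, fun D hD => ⟨?_, ?_⟩⟩
  · intro u
    obtain ⟨x, hx⟩ := hΨ (some u)
    exact ⟨x, by simp [hx]⟩
  · rw [← splitOff_amalgamation hA, ← hGF]
    rfl
  · intro u
    by_cases hu : u = α
    · subst hu
      have : (fun x => (Ψ x).getD u) ⁻¹' {u} = Ψ ⁻¹' {some u} ∪ Ψ ⁻¹' {none} := by
        ext x
        cases h : Ψ x <;> simp [h]
      rw [this, Set.ncard_union_eq, hfib, hfib]
      · simp [splitFun]; omega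
      · rw [Set.disjoint_left]
        intro x hx hx'
        rw [Set.mem_preimage, Set.mem_singleton_iff] at hx hx'
        rw [hx] at hx'
        cases hx'
    · have : (fun x => (Ψ x).getD α) ⁻¹' {u} = Ψ ⁻¹' {some u} := by
        ext x
        cases h : Ψ x <;> simp [h, Ne.symm hu]
      rw [this, hfib]
      simp [splitFun, hu]
  · intro x
    exact ((hfair D hD).1 x).trans
      (splitOff_degreeIn hA hα (hA1 _ ⟨D, Or.inl hD, rfl⟩) (Ψ x))
  · intro X
    have hmap : X.val.map (fun x => (Ψ x).getD α) = (X.val.map Ψ).map fun o => o.getD α := by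
      rw [Multiset.map_map]; rfl
    rw [hmap]
    refine ((hfair D hD).2 X).trans (splitOff_multiplicityIn hA hα hone (fun o => ?_)
      (hA2 _ ⟨_, ⟨_, D, hD, rfl⟩, rfl⟩))
    -- `X` has no repetitions, so it has at most as many elements over `o` as the fibre of `Ψ` does.
    rw [← hfib o, Multiset.count_map, ← Finset.filter_val, Finset.card_val,
      ← Set.ncard_coe_finset]
    refine Set.ncard_le_ncard (fun x hx => ?_) (Set.toFinite _)
    simp only [Finset.coe_filter, Set.mem_ofPred_eq] at hx
    exact hx.2.symm

/-! ### From edge sets to colour classes. -/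

theorem degreeIn_univ (G : HingeHypergraph V E H) (v : V) :
    G.degreeIn Set.univ v = G.degree v := by
  simp [degreeIn, degree]

theorem multiplicityIn_univ (G : HingeHypergraph V E H) (U : Multiset V) :
    G.multiplicityIn Set.univ U = G.multiplicity U := by
  simp [multiplicityIn, multiplicity]

variable {C : Type*}

theorem degree_colorClass (G : HingeHypergraph V E H) (c : E → C) (j : C) (v : V) :
    (G.colorClass c j).degree v = G.degreeIn (c ⁻¹' {j}) v := by
  rw [degree, degreeIn, ← Set.ncard_image_of_injective _ Subtype.val_injective]
  congr 1
  ext h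
  simp [hinges, colorClass]

theorem ncard_hingesAt_colorClass (G : HingeHypergraph V E H) (c : E → C) (j : C) (v : V)
    (e : {e : E // c e = j}) :
    ((G.colorClass c j).hingesAt v e).ncard = (G.hingesAt v e.1).ncard := by
  rw [← Set.ncard_image_of_injective _ Subtype.val_injective]
  congr 1
  ext h
  obtain ⟨e, he⟩ := e
  constructor
  · rintro ⟨a, ⟨h1, h2⟩, rfl⟩
    exact ⟨h1, congrArg Subtype.val h2⟩
  · rintro ⟨h1, h2⟩
    exact ⟨⟨h, h2 ▸ he⟩, ⟨h1, Subtype.ext h2⟩, rfl⟩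

theorem multiplicity_colorClass (G : HingeHypergraph V E H) (c : E → C) (j : C)
    (U : Multiset V) :
    (G.colorClass c j).multiplicity U = G.multiplicityIn (c ⁻¹' {j}) U := by
  classical
  rw [multiplicity, multiplicityIn, ← Set.ncard_image_of_injective _ Subtype.val_injective]
  congr 1
  ext e
  simp only [Set.mem_image, mem_edgesJoining, ncard_hingesAt_colorClass, Subtype.exists,
    exists_and_right, exists_eq_right, Set.mem_inter_iff, Set.mem_preimage,
    Set.mem_singleton_iff]
  exact ⟨fun ⟨h1, h2⟩ => ⟨h2, h1⟩, fun ⟨h1, h2⟩ => ⟨h2, h1⟩⟩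

theorem isLaminar_colors (c : E → C) :
    IsLaminar (insert Set.univ (Set.range fun j => c ⁻¹' {j})) := by
  rintro P (rfl | ⟨i, rfl⟩) Q (rfl | ⟨j, rfl⟩)
  · exact Or.inl le_rfl
  · exact Or.inr (Or.inl (Set.subset_univ _))
  · exact Or.inl (Set.subset_univ _)
  · by_cases h : i = j
    · subst h; exact Or.inl le_rfl
    · exact Or.inr (Or.inr (Disjoint.preimage c (by simpa using h)))

/-- The fairness of multiplicities, for a set of vertices given by its parts in the fibres over
distinct vertices. -/
theorem IsFairOn.multiplicityIn_sum {W : Type*} [Fintype V] [DecidableEq V]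
    {G : HingeHypergraph W E H} {F : HingeHypergraph V E H} {Ψ : W → V} {g : V → ℕ} {D : Set E}
    (h : G.IsFairOn F Ψ g D) {r : ℕ} {u : Fin r → V} {m : Fin r → ℕ} {U : Fin r → Finset W}
    (hu : Function.Injective u) (hU : ∀ i, (U i : Set W) ⊆ Ψ ⁻¹' {u i})
    (hm : ∀ i, (U i).card = m i) :
    FairShare (G.multiplicityIn D (∑ i, (U i).val))
      (F.multiplicityIn D (∑ i, Multiset.replicate (m i) (u i)) /
        ∏ i, ((g (u i)).choose (m i) : ℝ)) := by
  classical
  -- Parts lying over distinct vertices are disjoint, so their multiset sum comes from a single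
  -- finite set.
  have hdis : ((Finset.univ : Finset (Fin r)) : Set (Fin r)).PairwiseDisjoint U := by
    intro i _ j _ hij
    refine Finset.disjoint_left.2 fun x hi hj => hij (hu ?_)
    rw [← show Ψ x = u i from hU i hi, ← show Ψ x = u j from hU j hj]
  have hX : (Finset.univ.disjiUnion U hdis).val = ∑ i, (U i).val := by
    rw [Finset.disjiUnion_val]
    rfl
  have hmap : (∑ i, (U i).val).map Ψ = ∑ i, Multiset.replicate (m i) (u i) := by
    rw [← Multiset.coe_mapAddMonoidHom, map_sum]
    refine Finset.sum_congr rfl fun i _ => ?_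
    rw [Multiset.coe_mapAddMonoidHom, Multiset.eq_replicate]
    refine ⟨by rw [Multiset.card_map, Finset.card_val, hm], fun b hb => ?_⟩
    obtain ⟨x, hx, rfl⟩ := Multiset.mem_map.1 hb
    exact hU i hx
  have key := h.2 (Finset.univ.disjiUnion U hdis)
  rw [hX, hmap] at key
  convert key using 2
  have hcount : ∀ v, (∑ i, Multiset.replicate (m i) (u i)).count v =
      ∑ i, if u i = v then m i else 0 := by
    intro v
    rw [Multiset.count_sum']
    exact Finset.sum_congr rfl fun i _ => Multiset.count_replicate v (u i) (m i)
  -- Vertices not among the `u i` contribute the factor `(g v).choose 0 = 1`.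
  rw [← Finset.prod_subset (Finset.subset_univ (Finset.univ.image u)),
    Finset.prod_image fun i _ j _ hij => hu hij]
  · refine Finset.prod_congr rfl fun i _ => ?_
    rw [hcount]
    simp only [hu.eq_iff]
    simp
  · intro v _ hv
    rw [hcount, Finset.sum_eq_zero]
    · simp
    · intro i _
      rw [if_neg]
      rintro rfl
      exact hv (by simp)

end HingeHypergraph

theorem theorem4p1 {V : Type u} {E : Type v} {H : Type w} [Finite V] [Finite E] [Finite H]
    (F : HingeHypergraph V E H) (k : ℕ) (c : E → Fin k)
    (g : V → ℕ) (hpos : ∀ u, 0 < g u) (hg : F.IsSimpleFun g) :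
    ∃ (W : Type u) (_ : Finite W) (G : HingeHypergraph W E H) (Ψ : W → V),
      G.IsSimple ∧ G.IsDetachment F Ψ g ∧
      (∀ (u : V) (x : W), Ψ x = u →
        FairShare (G.degree x) ((F.degree u : ℝ) / g u)) ∧
      (∀ (u : V) (x : W), Ψ x = u → ∀ j : Fin k,
        FairShare ((G.colorClass c j).degree x) (((F.colorClass c j).degree u : ℝ) / g u)) ∧
      (∀ (r : ℕ) (u : Fin r → V) (m : Fin r → ℕ) (U : Fin r → Finset W),
        Function.Injective u → (∀ i, (U i : Set W) ⊆ Ψ ⁻¹' {u i}) →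
        (∀ i, (U i).card = m i ∧ m i ≤ g (u i)) →
        FairShare (G.multiplicity (∑ i, (U i).val))
          ((F.multiplicity (∑ i, Multiset.replicate (m i) (u i)) : ℝ) /
            ∏ i, ((g (u i)).choose (m i) : ℝ))) ∧
      (∀ (r : ℕ) (u : Fin r → V) (m : Fin r → ℕ) (U : Fin r → Finset W),
        Function.Injective u → (∀ i, (U i : Set W) ⊆ Ψ ⁻¹' {u i}) →
        (∀ i, (U i).card = m i ∧ m i ≤ g (u i)) → ∀ j : Fin k,
        FairShare ((G.colorClass c j).multiplicity (∑ i, (U i).val))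
          (((F.colorClass c j).multiplicity (∑ i, Multiset.replicate (m i) (u i)) : ℝ) /
            ∏ i, ((g (u i)).choose (m i) : ℝ))) := by
  classical
  have := Fintype.ofFinite V
  obtain ⟨W, hW, G, Ψ, hGs, hGF, hfair⟩ :=
    F.exists_fair_detachment (HingeHypergraph.isLaminar_colors c) g hpos hg
  have huniv := hfair Set.univ (Set.mem_insert _ _)
  have hcol : ∀ j, G.IsFairOn F Ψ g (c ⁻¹' {j}) :=
    fun j => hfair _ (Set.mem_insert_of_mem _ ⟨j, rfl⟩)
  refine ⟨W, hW, G, Ψ, hGs, hGF, ?_, ?_, ?_, ?_⟩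
  · rintro u x rfl
    simpa only [HingeHypergraph.degreeIn_univ] using huniv.1 x
  · rintro u x rfl j
    rw [HingeHypergraph.degree_colorClass, HingeHypergraph.degree_colorClass]
    exact (hcol j).1 x
  · intro r u m U hu hU hm
    have := huniv.multiplicityIn_sum hu hU fun i => (hm i).1
    simpa only [HingeHypergraph.multiplicityIn_univ] using this
  · intro r u m U hu hU hm j
    rw [HingeHypergraph.multiplicity_colorClass, HingeHypergraph.multiplicity_colorClass]
    exact (hcol j).multiplicityIn_sum hu hU fun i => (hm i).1
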